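/- Let $G$ be a Polish group, that is, a topological group whose topology is separable and completely metrizable. Call a subset $A\subseteq G$ universally measurable if for every Borel probability measure $\mu$ on $G$ the set $A$ differs from a Borel set by a set of $\mu$-measure $0$. Let $A\subseteq G$ be universally measurable and symmetric ($A=A^{-1}$), with $1\in A$, and suppose that $G$ is covered by countably many left translates of $A$, i.e. there is a countable set $D\subseteq G$ with $G=\bigcup_{g\in D} gA$. Then there is an integer $k\geq 1$ such that $A^k=\{a_1a_2\cdots a_k : a_1,\dots,a_k\in A\}$ is a neighbourhood of the identity $1$ in $G$. -/

import Mathlib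

open MeasureTheory Topology
open scoped Pointwise

/-- A subset `A` of a space `X`, equipped with its Borel `σ`-algebra, is *universally measurable*
if for every Borel probability measure `μ` on `X` it differs from a Borel set by a set of
`μ`-measure zero. (`NullMeasurableSet A μ` says that `A` is `μ`-a.e. equal to a measurable set.) -/
def IsUniversallyMeasurable {X : Type*} [MeasurableSpace X] (A : Set X) : Prop :=
  ∀ μ : Measure X, IsProbabilityMeasure μ → NullMeasurableSet A μ

/-! If elements of `K` tending fast to `1` escaped conjugation into `A²` by all earlier partial
products times `c`, their infinite products would map the Cantor group continuously to `G`. Pulling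
back a cover by translates of `A`, Steinhaus yields two points differing in one coordinate with
quotient in `A²`; that quotient is a forbidden conjugate. This proves
`IsUniversallyMeasurable.exists_finite_conj_mem`.

Taking suitable `K` and `c`, Neumann's lemma on coset covers and a centralizer argument make `H =
⟨A⟩` open (`Subgroup.isOpen_of_finite_conj_mem`). Finally `K = H` puts the finitely many conjugators
in one power of `A`. -/

/-- **Steinhaus for the Cantor group.** If countably many null-measurable sets cover `(ℤ/2)^ℕ`,
one of them contains two points that differ in exactly one coordinate. -/
theorem exists_add_single_mem {ι : Type*} [Countable ι] (μ : Measure (ℕ → ZMod 2))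
    [μ.IsAddHaarMeasure] (E : ι → Set (ℕ → ZMod 2)) (hE : ∀ i, NullMeasurableSet (E i) μ)
    (hcover : ⋃ i, E i = Set.univ) :
    ∃ i n, ∃ x ∈ E i, x + Pi.single n 1 ∈ E i := by
  obtain ⟨i, hi⟩ : ∃ i, 0 < μ (E i) := by
    by_contra! h
    have h0 : μ (⋃ i, E i) = 0 := measure_iUnion_null fun i ↦ nonpos_iff_eq_zero.1 (h i)
    rw [hcover] at h0
    exact (isOpen_univ.measure_pos μ Set.univ_nonempty).ne' h0
  obtain ⟨F, hFE, hF, hFe⟩ := (hE i).exists_measurable_subset_ae_eq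
  have hpos : 0 < μ F := by rwa [measure_congr hFe]
  have hnhds : F - F ∈ 𝓝 (0 : ℕ → ZMod 2) :=
    Measure.sub_mem_nhds_zero_of_addHaar_pos_ne_top μ F hF hpos (measure_ne_top μ F)
  have htend : Filter.Tendsto (fun n : ℕ ↦ (Pi.single n 1 : ℕ → ZMod 2)) Filter.atTop (𝓝 0) := by
    rw [tendsto_pi_nhds]
    intro k
    refine tendsto_const_nhds.congr' ?_
    filter_upwards [Filter.eventually_gt_atTop k] with n hn
    simp [hn.ne]
  obtain ⟨n, hn⟩ := (htend.eventually hnhds).exists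
  obtain ⟨x, hx, y, hy, hxy⟩ := hn
  exact ⟨i, n, y, hFE hy, by rw [← hxy, add_sub_cancel]; exact hFE hx⟩

section

variable {G : Type*} [Group G]

/-- The push-forward of `μ` depends on `f`, so `A` must be measurable for all measures at once. -/
theorem IsUniversallyMeasurable.nullMeasurableSet_preimage {X Y : Type*} [MeasurableSpace X]
    [MeasurableSpace Y] {A : Set Y} (hA : IsUniversallyMeasurable A) {μ : Measure X}
    [IsProbabilityMeasure μ] {f : X → Y} (hf : Measurable f) : NullMeasurableSet (f ⁻¹' A) μ :=
  (hA (μ.map f) (Measure.isProbabilityMeasure_map hf.aemeasurable)).preimage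
    (hf.measurePreserving μ).quasiMeasurePreserving

/-- A continuous map from the Cantor group to a group covered by countably many right translates
of a universally measurable set `A` has two values at points differing in one coordinate whose
quotient lies in `A / A`. -/
theorem IsUniversallyMeasurable.exists_mul_inv_mem [TopologicalSpace G] [IsTopologicalGroup G]
    [MeasurableSpace G] [BorelSpace G] {A : Set G} (hA : IsUniversallyMeasurable A)
    {D : Set G} (hD : D.Countable) (hcover : ∀ x, ∃ d ∈ D, x * d ∈ A)
    {f : (ℕ → ZMod 2) → G} (hf : Continuous f) :
    ∃ n x, f (x + Pi.single n 1) * (f x)⁻¹ ∈ A * A⁻¹ := by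
  have := hD.to_subtype
  let K₀ : TopologicalSpace.PositiveCompacts (ℕ → ZMod 2) := ⊤
  let μ : Measure (ℕ → ZMod 2) := Measure.addHaarMeasure K₀
  have hμ : IsProbabilityMeasure μ := ⟨Measure.addHaarMeasure_self (K₀ := K₀)⟩
  obtain ⟨d, n, x, hx, hy⟩ := exists_add_single_mem μ (fun d : D ↦ (fun x ↦ f x * d) ⁻¹' A)
    (fun d ↦ hA.nullMeasurableSet_preimage (hf.mul_const _).measurable)
    (Set.eq_univ_of_forall fun x ↦ by
      obtain ⟨d, hd, h⟩ := hcover (f x)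
      exact Set.mem_iUnion.2 ⟨⟨d, hd⟩, h⟩)
  refine ⟨n, x, f (x + Pi.single n 1) * d, hy, (f x * d)⁻¹, Set.inv_mem_inv.2 hx, by group⟩

/-- The product `∏_{i < n} g i ^ x i`, where the exponents `x i` are `0` or `1`. -/
def partialProd (g : ℕ → G) (x : ℕ → ZMod 2) : ℕ → G
  | 0 => 1
  | n + 1 => partialProd g x n * (if x n = 0 then 1 else g n)

theorem partialProd_congr (g : ℕ → G) {x y : ℕ → ZMod 2} {n : ℕ} (h : ∀ i < n, x i = y i) :
    partialProd g x n = partialProd g y n := by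
  induction n with
  | zero => rfl
  | succ n ih => rw [partialProd, partialProd, ih fun i hi ↦ h i (by omega), h n (by omega)]

theorem partialProd_mem (g : ℕ → G) (x : ℕ → ZMod 2) {F : ℕ → Set G} (h0 : 1 ∈ F 0)
    (hmono : ∀ n, F n ⊆ F (n + 1)) (hmul : ∀ n, ∀ a ∈ F n, a * g n ∈ F (n + 1)) (n : ℕ) :
    partialProd g x n ∈ F n := by
  induction n with
  | zero => exact h0
  | succ n ih =>
    rw [partialProd]
    split_ifs
    · simpa using hmono n ih
    · exact hmul n _ ih

theorem continuous_partialProd [TopologicalSpace G] [ContinuousMul G] (g : ℕ → G) (n : ℕ) :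
    Continuous fun x ↦ partialProd g x n := by
  induction n with
  | zero => exact continuous_const
  | succ n ih =>
    have h : Continuous fun t : ZMod 2 ↦ if t = 0 then (1 : G) else g n :=
      continuous_of_discreteTopology
    exact ih.mul (h.comp (continuous_apply n))

/-- Changing the `n`-th exponent conjugates `g n` by the partial product of length `n`. -/
theorem partialProd_add_single (g : ℕ → G) {x : ℕ → ZMod 2} {n : ℕ} (hx : x n = 0) {m : ℕ}
    (hm : n < m) :
    partialProd g (x + Pi.single n 1) m =
      (partialProd g x n * g n * (partialProd g x n)⁻¹) * partialProd g x m := by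
  induction m, hm using Nat.le_induction with
  | base =>
    have : partialProd g (x + Pi.single n 1) n = partialProd g x n :=
      partialProd_congr g fun i hi ↦ by simp [hi.ne]
    simp [partialProd, this, hx]
  | succ m hm ih =>
    have : (x + Pi.single n 1 : ℕ → ZMod 2) m = x m := by
      simp [(show m ≠ n by omega)]
    rw [partialProd, ih, this, partialProd.eq_2 g x m, mul_assoc]

end

open Filter in
/-- Let countably many right translates of the universally measurable set `A` cover `G`, and let the
infinite products `c * ∏ g n ^ x n` converge uniformly. Then some `g n` is conjugated into `A²` by
`c * a` for one of the partial products `a` of length `n`. -/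
theorem IsUniversallyMeasurable.exists_conj_mem {G : Type*} [Group G] [MetricSpace G]
    [CompleteSpace G] [IsTopologicalGroup G] [MeasurableSpace G] [BorelSpace G] {A : Set G}
    (hA : IsUniversallyMeasurable A) (hsymm : A⁻¹ = A)
    {D : Set G} (hD : D.Countable) (hcover : ∀ x, ∃ d ∈ D, x * d ∈ A)
    (c : G) (g : ℕ → G) {F : ℕ → Set G} (h0 : 1 ∈ F 0)
    (hmono : ∀ n, F n ⊆ F (n + 1)) (hmul : ∀ n, ∀ a ∈ F n, a * g n ∈ F (n + 1))
    (hdist : ∀ n, ∀ a ∈ F n, dist (c * a) (c * a * g n) ≤ 1 / 2 ^ n) :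
    ∃ n, ∃ a ∈ F n, (c * a) * g n * (c * a)⁻¹ ∈ A * A := by
  have hstep (x : ℕ → ZMod 2) (n : ℕ) :
      dist (c * partialProd g x n) (c * partialProd g x (n + 1)) ≤ 2 / 2 / 2 ^ n := by
    rw [partialProd, div_self two_ne_zero]
    split_ifs
    · simp
    · rw [← mul_assoc]
      exact hdist n _ (partialProd_mem g x h0 hmono hmul n)
  choose f hf using fun x ↦
    cauchySeq_tendsto_of_complete (cauchySeq_of_le_geometric_two (hstep x))
  have hunif : TendstoUniformly (fun n x ↦ c * partialProd g x n) f atTop := by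
    rw [Metric.tendstoUniformly_iff]
    intro ε hε
    have hlim : Tendsto (fun n : ℕ ↦ (2 : ℝ) / 2 ^ n) atTop (𝓝 0) :=
      tendsto_const_nhds.div_atTop (tendsto_pow_atTop_atTop_of_one_lt one_lt_two)
    filter_upwards [hlim.eventually (gt_mem_nhds hε)] with n hn x
    rw [dist_comm]
    exact (dist_le_of_le_geometric_two_of_tendsto (hstep x) (hf x) n).trans_lt hn
  have hcont : Continuous f :=
    hunif.continuous (Frequently.of_forall fun n ↦ (continuous_partialProd g n).const_mul c)
  have key (x : ℕ → ZMod 2) (n : ℕ) (hx : x n = 0) : f (x + Pi.single n 1) * (f x)⁻¹ =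
      (c * partialProd g x n) * g n * (c * partialProd g x n)⁻¹ := by
    refine tendsto_nhds_unique ((hf _).mul (hf x).inv) (tendsto_const_nhds.congr' ?_)
    filter_upwards [eventually_gt_atTop n] with m hm
    rw [partialProd_add_single g hx hm]
    group
  obtain ⟨n, x, hnx⟩ := hA.exists_mul_inv_mem hD hcover hcont
  rw [hsymm] at hnx
  have h01 : x n = 0 ∨ x n = 1 := by generalize x n = t; revert t; decide
  obtain hx | hx := h01
  · exact ⟨n, _, partialProd_mem g x h0 hmono hmul n, key x n hx ▸ hnx⟩
  -- Adding the same unit vector again returns to `x`, so the two points swap roles and the quotient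
  -- is inverted.
  · set y := x + Pi.single n 1 with hy
    have hyn : y n = 0 := by simp only [hy, Pi.add_apply, hx, Pi.single_eq_same]; decide
    have hyx : y + Pi.single n 1 = x := by
      rw [hy, add_assoc, ← Pi.single_add, (by decide : (1 + 1 : ZMod 2) = 0), Pi.single_zero,
        add_zero]
    refine ⟨n, _, partialProd_mem g y h0 hmono hmul n, ?_⟩
    rw [← key y n hyn, hyx, ← Set.inv_mem_inv]
    simpa [mul_inv_rev, hsymm] using hnx

/-- Let `A` be universally measurable, with countably many right translates covering the Polish
group `G`. For every submonoid `K` and every `c`, all elements of `K` close to `1` are conjugated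
into `A²` by one of finitely many elements of `c K`. -/
theorem IsUniversallyMeasurable.exists_finite_conj_mem {G : Type*} [Group G]
    [TopologicalSpace G] [IsTopologicalGroup G] [PolishSpace G] [MeasurableSpace G] [BorelSpace G] {A : Set G}
    (hA : IsUniversallyMeasurable A) (hsymm : A⁻¹ = A)
    {D : Set G} (hD : D.Countable) (hcover : ∀ x, ∃ d ∈ D, x * d ∈ A)
    (K : Submonoid G) (c : G) :
    ∃ F : Set G, F.Finite ∧ F ⊆ K ∧ ∃ V ∈ 𝓝 (1 : G), ∀ g ∈ V, g ∈ K →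
      ∃ a ∈ F, (c * a) * g * (c * a)⁻¹ ∈ A * A := by
  let := TopologicalSpace.upgradeIsCompletelyMetrizable G
  by_contra! hcon
  have hnext (F : {F : Set G // F.Finite ∧ F ⊆ K}) (n : ℕ) : ∃ g ∈ K,
      (∀ a ∈ F.1, dist (c * a) (c * a * g) ≤ 1 / 2 ^ n) ∧
      ∀ a ∈ F.1, (c * a) * g * (c * a)⁻¹ ∉ A * A := by
    have hV : ∀ᶠ g in 𝓝 (1 : G), ∀ a ∈ F.1, dist (c * a) (c * a * g) < 1 / 2 ^ n := by
      rw [Filter.eventually_all_finite F.2.1]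
      intro a _
      have : Continuous fun g ↦ dist (c * a) (c * a * g) := by fun_prop
      exact this.continuousAt.eventually_lt_const (by simp)
    obtain ⟨g, hgV, hgK, hg⟩ := hcon F.1 F.2.1 F.2.2 _ hV
    exact ⟨g, hgK, fun a ha ↦ (hgV a ha).le, hg⟩
  choose next hK hdist hnot using hnext
  -- `S n` collects all partial products of length `n`.
  let S : ℕ → {F : Set G // F.Finite ∧ F ⊆ K} := fun n ↦ n.rec
    ⟨{1}, Set.finite_singleton 1, by simp⟩
    fun n F ↦ ⟨F.1 ∪ (· * next F n) '' F.1, F.2.1.union (F.2.1.image _),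
      Set.union_subset F.2.2 (Set.image_subset_iff.2 fun a ha ↦ K.mul_mem (F.2.2 ha) (hK F n))⟩
  obtain ⟨n, a, ha, h⟩ := hA.exists_conj_mem hsymm hD hcover c (fun n ↦ next (S n) n)
    (F := fun n ↦ (S n).1) rfl (fun n ↦ Set.subset_union_left)
    (fun n a ha ↦ Or.inr ⟨a, ha, rfl⟩) (fun n ↦ hdist (S n) n)
  exact hnot (S n) n a ha h

/-! ### Openness of subgroups of countable index -/

/-- The preimage of `H` under conjugation by `a`. -/
def Subgroup.conjComap {G : Type*} [Group G] (H : Subgroup G) (a : G) : Subgroup G :=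
  H.comap (MulAut.conj a).toMonoidHom

theorem Subgroup.mem_conjComap {G : Type*} [Group G] {H : Subgroup G} {a x : G} :
    x ∈ H.conjComap a ↔ a * x * a⁻¹ ∈ H := Iff.rfl

section

variable {G : Type*} [Group G] [TopologicalSpace G] [IsTopologicalGroup G]

/-- In a Baire group, a subgroup containing all quotients within the fibres of a countable-valued
map has open closure. -/
theorem Subgroup.isOpen_topologicalClosure_of_countable [BaireSpace G] {X : Type*}
    [Countable X] (D : Subgroup G) (f : G → X) (hf : ∀ x y, f x = f y → x⁻¹ * y ∈ D) :
    IsOpen (D.topologicalClosure : Set G) := by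
  -- By Baire, the closure of some fibre has interior.
  have hcov : ⋃ t : Set.range f, _root_.closure (f ⁻¹' {t.1}) = Set.univ :=
    Set.eq_univ_of_forall fun x ↦
      Set.mem_iUnion.2 ⟨⟨f x, x, rfl⟩, _root_.subset_closure (Set.mem_singleton (f x))⟩
  obtain ⟨⟨_, x, rfl⟩, y, hy⟩ := nonempty_interior_of_iUnion_of_closed
    (f := fun t : Set.range f ↦ _root_.closure (f ⁻¹' {t.1})) (fun _ ↦ isClosed_closure) hcov
  rw [mem_interior_iff_mem_nhds] at hy
  have hsub : _root_.closure (f ⁻¹' {f x}) ⊆ (fun z ↦ x⁻¹ * z) ⁻¹' (D.topologicalClosure : Set G) :=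
    closure_minimal (fun z hz ↦ D.le_topologicalClosure (hf x z (Eq.symm hz)))
      (D.isClosed_topologicalClosure.preimage (continuous_const_mul _))
  refine D.topologicalClosure.isOpen_of_mem_nhds (g := x⁻¹ * y) ?_
  have := Filter.mem_of_superset hy hsub
  rw [← Filter.mem_map] at this
  rwa [← map_mul_left_nhds]

theorem Subgroup.exists_mul_inv_mem_of_mem_topologicalClosure {D : Subgroup G} {x : G}
    (hx : x ∈ D.topologicalClosure) {V : Set G} (hV : V ∈ 𝓝 (1 : G)) : ∃ d ∈ D, x * d⁻¹ ∈ V := by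
  have hcont : Continuous fun d : G ↦ x * d⁻¹ := by fun_prop
  have : (fun d : G ↦ x * d⁻¹) ⁻¹' V ∈ 𝓝 x := hcont.continuousAt (by simpa using hV)
  obtain ⟨d, hdV, hd⟩ := mem_closure_iff_nhds.1 hx _ this
  exact ⟨d, hd, hdV⟩

/-- If all elements near `1` of each submonoid `K` are conjugated into the subgroup `H` of
countable index by finitely many elements of each `c K`, then `H` is open. -/
theorem Subgroup.isOpen_of_finite_conj_mem [BaireSpace G] (H : Subgroup G) [Countable (G ⧸ H)]
    (hH : ∀ (K : Submonoid G) (c : G), ∃ F : Set G, F.Finite ∧ F ⊆ K ∧ ∃ V ∈ 𝓝 (1 : G), ∀ g ∈ V,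
      g ∈ K → ∃ a ∈ F, (c * a) * g * (c * a)⁻¹ ∈ H) :
    IsOpen (H : Set G) := by
  classical
  obtain ⟨F, hF, -, V, hV, hVF⟩ := hH ⊤ 1
  simp only [Submonoid.mem_top, one_mul, forall_const, ← mem_conjComap] at hVF
  lift F to Finset G using hF
  let D : Subgroup G := ⨅ a ∈ F, H.conjComap a
  have hD {a x : G} (ha : a ∈ F) (hx : x ∈ D) : x ∈ H.conjComap a :=
    iInf₂_le (α := Subgroup G) a ha hx
  set L := D.topologicalClosure
  have hL : IsOpen (L : Set G) := by
    refine D.isOpen_topologicalClosure_of_countable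
      (fun x (a : F) ↦ (QuotientGroup.mk (x * (a : G)⁻¹) : G ⧸ H)) fun x y hxy ↦ ?_
    simp only [D, Subgroup.mem_iInf]
    intro a ha
    have := QuotientGroup.eq.1 (congrFun hxy ⟨a, ha⟩)
    rw [mem_conjComap]
    simpa [mul_assoc] using this
  -- `D` lies in every conjugate, so an element of `L` may be moved into `V` by `D`.
  have hcover : ∀ x ∈ L, ∃ a ∈ F, x ∈ H.conjComap a := fun x hx ↦ by
    obtain ⟨d, hd, hdV⟩ := exists_mul_inv_mem_of_mem_topologicalClosure hx hV
    obtain ⟨a, ha, hax⟩ := hVF _ hdV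
    exact ⟨a, ha, ((H.conjComap a).mul_mem_cancel_right (inv_mem (hD ha hd))).1 hax⟩
  -- B. H. Neumann's lemma.
  obtain ⟨c, -, hc⟩ := Subgroup.exists_finiteIndex_of_leftCoset_cover (G := L) (s := F)
    (H := fun a ↦ (H.conjComap a).subgroupOf L) (g := fun _ ↦ 1) (by
      refine Set.eq_univ_of_forall fun x ↦ ?_
      obtain ⟨a, ha, hax⟩ := hcover x x.2
      simp only [one_smul, Set.mem_iUnion]
      exact ⟨a, ha, hax⟩)
  let N : Subgroup L := ((H.conjComap c).subgroupOf L).normalCore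
  have : N.topologicalClosure.FiniteIndex := finiteIndex_of_le N.le_topologicalClosure
  have hNo : IsOpen (N.topologicalClosure : Set L) :=
    isOpen_of_isClosed_of_finiteIndex _ N.isClosed_topologicalClosure
  have hle : N.topologicalClosure ≤ (H.conjComap c).subgroupOf L := by
    intro q hq
    by_contra hqH
    -- Conjugation by elements of `K` fixes `q` modulo `N`, so a conjugate of `q * n⁻¹` in
    -- `H.conjComap c` forces `q` into it.
    let K : Subgroup L := (centralizer {(q : L ⧸ N)}).comap (QuotientGroup.mk' N)
    obtain ⟨F', -, hF'K, V', hV', hVF'⟩ := hH (K.map L.subtype).toSubmonoid c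
    obtain ⟨n, hn, hnV⟩ := exists_mul_inv_mem_of_mem_topologicalClosure hq
      (continuous_subtype_val.continuousAt.preimage_mem_nhds (x := (1 : L)) hV')
    have hqn : ((q * n⁻¹ : L) : L ⧸ N) = q := by
      rw [QuotientGroup.eq]; simpa using hn
    obtain ⟨a, ha, haH⟩ := hVF' _ hnV
      ⟨q * n⁻¹, by simp [K, hqn, mem_centralizer_iff], rfl⟩
    obtain ⟨a, haK, rfl⟩ := hF'K ha
    have hcomm : (q : L ⧸ N) * a = a * q := by
      simpa [K, mem_centralizer_iff] using haK
    have hz : (q⁻¹ * (a * (q * n⁻¹) * a⁻¹) : L) ∈ N := by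
      rw [← QuotientGroup.eq, QuotientGroup.mk_mul, QuotientGroup.mk_mul, hqn, ← hcomm,
        QuotientGroup.mk_inv, mul_inv_cancel_right]
    have hconj : (a * (q * n⁻¹) * a⁻¹ : L) ∈ (H.conjComap c).subgroupOf L := by
      rw [mem_subgroupOf, mem_conjComap]
      simpa [mul_assoc] using haH
    refine hqH ?_
    simpa [mul_assoc] using mul_mem hconj (inv_mem (normalCore_le _ hz))
  have hmem : (H.conjComap c : Set G) ∈ 𝓝 1 := by
    have := (hL.isOpenMap_subtype_val _ hNo).mem_nhds (x := 1) ⟨1, one_mem _, rfl⟩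
    refine Filter.mem_of_superset this ?_
    rintro _ ⟨x, hx, rfl⟩
    exact hle hx
  have hcont : Continuous fun x : G ↦ c⁻¹ * x * c := by fun_prop
  refine H.isOpen_of_mem_nhds (g := 1) ?_
  filter_upwards [hcont.continuousAt.preimage_mem_nhds (x := 1) (by simpa using hmem)] with x hx
  have := mem_conjComap.1 hx
  simpa [mul_assoc] using this

end

theorem Set.exists_mem_pow_of_mem_closure {G : Type*} [Group G] {A : Set G} (hsymm : A⁻¹ = A)
    {x : G} (hx : x ∈ Subgroup.closure A) : ∃ n : ℕ, x ∈ A ^ n := by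
  rw [← Subgroup.mem_toSubmonoid, Subgroup.closure_toSubmonoid, hsymm, Set.union_self] at hx
  induction hx using Submonoid.closure_induction with
  | mem x hx => exact ⟨1, by simpa⟩
  | one => exact ⟨0, by simp⟩
  | mul x y _ _ hx hy =>
    obtain ⟨m, hm⟩ := hx
    obtain ⟨n, hn⟩ := hy
    exact ⟨m + n, pow_add A m n ▸ Set.mul_mem_mul hm hn⟩

theorem mainTheorem3 {G : Type*} [Group G] [TopologicalSpace G] [IsTopologicalGroup G]
    [PolishSpace G] [MeasurableSpace G] [BorelSpace G] (A : Set G)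
    (hA : IsUniversallyMeasurable A) (hsymm : A⁻¹ = A) (hone : (1 : G) ∈ A)
    (hcover : ∃ D : Set G, D.Countable ∧ ⋃ g ∈ D, g • A = Set.univ) :
    ∃ k : ℕ, 1 ≤ k ∧ A ^ k ∈ 𝓝 (1 : G) := by
  obtain ⟨D, hD, hDA⟩ := hcover
  have hleft (x : G) : ∃ d ∈ D, d⁻¹ * x ∈ A := by
    have := hDA.ge (Set.mem_univ x)
    simpa only [Set.mem_iUnion₂, exists_prop, Set.mem_smul_set_iff_inv_smul_mem, smul_eq_mul]
      using this
  have hright (x : G) : ∃ d ∈ D, x * d ∈ A := by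
    obtain ⟨d, hd, h⟩ := hleft x⁻¹
    refine ⟨d, hd, ?_⟩
    rw [← hsymm]
    simpa using h
  have hkey := hA.exists_finite_conj_mem hsymm hD hright
  set H := Subgroup.closure A
  have hAH : A ⊆ H := Subgroup.subset_closure
  have : Countable (G ⧸ H) := by
    have := hD.to_subtype
    refine Function.Surjective.countable (f := fun d : D ↦ (QuotientGroup.mk d.1 : G ⧸ H)) ?_
    intro t
    obtain ⟨x, rfl⟩ := QuotientGroup.mk_surjective t
    obtain ⟨d, hd, h⟩ := hleft x
    exact ⟨⟨d, hd⟩, QuotientGroup.eq.2 (hAH h)⟩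
  have hopen : IsOpen (H : Set G) := by
    refine H.isOpen_of_finite_conj_mem fun K c ↦ ?_
    obtain ⟨F, hF, hFK, V, hV, h⟩ := hkey K c
    refine ⟨F, hF, hFK, V, hV, fun g hg hgK ↦ ?_⟩
    obtain ⟨a, ha, x, hx, y, hy, hxy⟩ := h g hg hgK
    exact ⟨a, ha, hxy ▸ mul_mem (hAH hx) (hAH hy)⟩
  obtain ⟨F, hF, hFH, V, hV, h⟩ := hkey H.toSubmonoid 1
  have hbound : ∃ m, ∀ a ∈ F, a ∈ A ^ m ∧ a⁻¹ ∈ A ^ m := by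
    choose! n hn using fun a (ha : a ∈ F) ↦ Set.exists_mem_pow_of_mem_closure hsymm (hFH ha)
    obtain ⟨m, hm⟩ := (hF.image n).bddAbove
    refine ⟨m, fun a ha ↦ ?_⟩
    have : a ∈ A ^ m := Set.pow_subset_pow_right hone (hm ⟨a, ha, rfl⟩) (hn a ha)
    refine ⟨this, ?_⟩
    rw [← hsymm, inv_pow]
    simpa using this
  obtain ⟨m, hm⟩ := hbound
  -- `g = a⁻¹ * (a * g * a⁻¹) * a`, with middle factor in `A²`.
  refine ⟨m + 2 + m, by omega, ?_⟩
  filter_upwards [hV, hopen.mem_nhds (one_mem H)] with g hgV hgH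
  obtain ⟨a, ha, hag⟩ := h g hgV hgH
  rw [pow_add, pow_add, sq]
  have := Set.mul_mem_mul (Set.mul_mem_mul (hm a ha).2 hag) (hm a ha).1
  simpa [mul_assoc] using this
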